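/- Let $\mathcal A$ be a finite alphabet; words are elements of the free monoid $\mathcal A^*$ and sequences are elements of $\mathcal A^\omega$ (right infinite words). A word $u$ is a factor of a sequence $s$ if $s=pus'$ for some $p\in\mathcal A^*$ and $s'\in\mathcal A^\omega$. A sequence $s$ is standard episturmian if for every prefix $u$ of $s$, the right palindromic closure $u^{(+)}$ (the shortest palindrome having $u$ as a prefix) is also a prefix of $s$. A sequence is episturmian if it has the same set of factors as some standard episturmian sequence. For letters $a,b$ define endomorphisms of $\mathcal A^*$ by $\psi_a(a)=\overline\psi_a(a)=a$, $\psi_a(x)=ax$ and $\overline\psi_a(x)=xa$ for letters $x\ne a$, and let $\theta_{ab}$ exchange $a$ and $b$ and fix the other letters. The episturmian morphisms are the elements of the monoid generated under composition by all $\psi_a,\overline\psi_a,\theta_{ab}$. A word is c-epichristoffel if it is the image of a letter under an episturmian morphism. An integer $p\ge 1$ is a (nontrivial) period of $w=w[0]\cdots w[n-1]$ if $w[i]=w[i+p]$ for all $0\le i<n-p$. The fractional root of a nonempty word $w$ is its prefix $z_w$ whose length is the smallest nontrivial period of $w$. **Theorem.** Let $w\in\mathcal A^*$ be a nonempty word whose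 fractional root $z_w$ is c-epichristoffel. Then $w$ is a factor of an episturmian sequence over $\mathcal A$. The reverse implication fails: if $\mathcal A$ has at least three letters, then there is a nonempty word $w\in\mathcal A^*$ that is a factor of an episturmian sequence over $\mathcal A$ but whose fractional root is not c-epichristoffel. -/

import Mathlib

/-- `IsRightPalClosure u v`: the word `v` is the right palindromic closure `u⁽⁺⁾` of the finite
word `u`, that is, the shortest palindrome having `u` as a prefix. -/
def IsRightPalClosure {A : Type*} (u v : List A) : Prop :=
  (v.Palindrome ∧ u <+: v) ∧ ∀ v' : List A, v'.Palindrome → u <+: v' → v.length ≤ v'.length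

/-- Every finite word has exactly one right palindromic closure. -/
theorem existsUnique_isRightPalClosure {A : Type*} (u : List A) :
    ∃! v : List A, IsRightPalClosure u v := by
  classical
  have hne : ∃ n : ℕ, ∃ v : List A, v.length = n ∧ v.Palindrome ∧ u <+: v :=
    ⟨_, u ++ u.reverse, rfl, List.Palindrome.of_reverse_eq (by simp), List.prefix_append _ _⟩
  obtain ⟨v, hlen, hpal, hpre⟩ := Nat.find_spec hne
  refine ⟨v, ⟨⟨hpal, hpre⟩, fun v' h1 h2 => ?_⟩, ?_⟩
  · rw [hlen]
    exact Nat.find_min' hne ⟨v', rfl, h1, h2⟩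
  · rintro v' ⟨⟨hpal', hpre'⟩, hmin'⟩
    have hl : v'.length = v.length :=
      le_antisymm (hmin' v hpal hpre) (hlen ▸ Nat.find_min' hne ⟨v', rfl, hpal', hpre'⟩)
    have h2 : v.length ≤ u.length + u.length := by
      have := Nat.find_min' hne ⟨u ++ u.reverse, rfl,
        List.Palindrome.of_reverse_eq (by simp), List.prefix_append _ _⟩
      rw [← hlen] at this
      simpa using this
    have key : ∀ x : List A, x.Palindrome → ∀ i (hi : i < x.length),
        x[i] = x[x.length - 1 - i] := by
      intro x hx i hi
      have h := List.getElem_reverse (l := x) (i := i) (by simpa using hi)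
      simpa [hx.reverse_eq] using h
    have low : ∀ i (hi : i < u.length) (h1 : i < v'.length) (h3 : i < v.length),
        v'[i] = v[i] := by
      intro i hi h1 h3
      rw [← hpre'.getElem hi, ← hpre.getElem hi]
    refine List.ext_getElem hl fun i h1 h3 => ?_
    by_cases hi : i < u.length
    · exact low i hi h1 h3
    · rw [key v' hpal' i h1, key v hpal i h3]
      simp only [hl]
      exact low _ (by omega) _ _

/-- The finite word `u` is a prefix of the sequence (right infinite word) `s`. -/
def IsSeqPrefix {A : Type*} (u : List A) (s : ℕ → A) : Prop :=
  ∀ (i : ℕ) (hi : i < u.length), u[i] = s i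

/-- The finite word `u` is a factor of the sequence `s`. -/
def IsSeqFactor {A : Type*} (u : List A) (s : ℕ → A) : Prop :=
  ∃ k : ℕ, ∀ (i : ℕ) (hi : i < u.length), u[i] = s (k + i)

/-- A sequence is standard episturmian if the right palindromic closure of each of its prefixes is
again one of its prefixes. -/
def IsStandardEpisturmian {A : Type*} (s : ℕ → A) : Prop :=
  ∀ u : List A, IsSeqPrefix u s → ∃ v : List A, IsRightPalClosure u v ∧ IsSeqPrefix v s

/-- A sequence is episturmian if it has the same set of factors as some standard episturmian
sequence. -/
def IsEpisturmian {A : Type*} (t : ℕ → A) : Prop :=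
  ∃ s : ℕ → A, IsStandardEpisturmian s ∧ {u | IsSeqFactor u t} = {u | IsSeqFactor u s}

/-- The endomorphism `ψ_a` of the free monoid: `a ↦ a`, and `x ↦ ax` for `x ≠ a`. -/
def psi {A : Type*} [DecidableEq A] (a : A) : Monoid.End (FreeMonoid A) :=
  FreeMonoid.lift fun x =>
    if x = a then FreeMonoid.of a else FreeMonoid.of a * FreeMonoid.of x

/-- The endomorphism `ψ̄_a` of the free monoid: `a ↦ a`, and `x ↦ xa` for `x ≠ a`. -/
def psiBar {A : Type*} [DecidableEq A] (a : A) : Monoid.End (FreeMonoid A) :=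
  FreeMonoid.lift fun x =>
    if x = a then FreeMonoid.of a else FreeMonoid.of x * FreeMonoid.of a

/-- The endomorphism `θ_{ab}` of the free monoid exchanging the letters `a` and `b`. -/
def theta {A : Type*} [DecidableEq A] (a b : A) : Monoid.End (FreeMonoid A) :=
  FreeMonoid.map (Equiv.swap a b)

/-- The monoid of episturmian morphisms, generated under composition by all `ψ_a`, `ψ̄_a` and
`θ_{ab}`. -/
def episturmianMorphisms (A : Type*) [DecidableEq A] : Submonoid (Monoid.End (FreeMonoid A)) :=
  Submonoid.closure
    (Set.range psi ∪ Set.range psiBar ∪ Set.range fun p : A × A => theta p.1 p.2)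

/-- A finite word is c-epichristoffel (belongs to an epichristoffel class) if it is the image of a
letter under an episturmian morphism. -/
def IsCEpichristoffel {A : Type*} [DecidableEq A] (w : List A) : Prop :=
  ∃ f ∈ episturmianMorphisms A, ∃ a : A, f (FreeMonoid.of a) = FreeMonoid.ofList w

/-- The smallest nontrivial (that is, nonzero) period of a finite word. -/
noncomputable def smallestPeriod {A : Type*} (w : List A) : ℕ :=
  sInf {p : ℕ | p ≠ 0 ∧ w.HasPeriod p}

/-- The fractional root of a finite word: its prefix whose length is its smallest nontrivial
period. -/
noncomputable def fractionalRoot {A : Type*} (w : List A) : List A :=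
  w.take (smallestPeriod w)

/-! ### Palindromic closure via longest palindromic suffixes -/

section PalindromicClosure

variable {A : Type*}

/-! If `z` is the fractional root and `z = f(a)` with `f` episturmian, then `w` is a prefix of a
power of `z`, hence of some `f(a^n)`. The constant sequence `a^ω` is standard episturmian, so it
suffices that episturmian morphisms carry the factors of a standard episturmian sequence to factors
of another one (`exists_isStandardEpisturmian_of_mem`). This is checked on generators: `θ` relabels
letters, `ψ̄_a` is conjugate to `ψ_a` by `a`, and `ψ_a` preserves standardness
(`IsStandardEpisturmian.psiSeq`) because `u ↦ ψ_a(u)a` preserves and reflects palindromes and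
commutes with palindromic closure.

For the converse, take distinct `a`, `b`, `c`. The word `bac` occurs in `(abac)^ω = ψ_a ψ_b (c^ω)`
and is its own fractional root. At least half of the letters of any image of `ψ_a` or `ψ̄_a` are
`a`, so a c-epichristoffel word without repeated letters has length at most two. -/

/-- The right palindromic closure is obtained by completing a longest palindromic suffix. -/
theorem isRightPalClosure_of_longest {x y : List A} (hy : y.Palindrome)
    (hmin : ∀ x' y' : List A, x' ++ y' = x ++ y → y'.Palindrome → x.length ≤ x'.length) :
    IsRightPalClosure (x ++ y) (x ++ y ++ x.reverse) := by
  refine ⟨⟨List.Palindrome.of_reverse_eq (by simp [hy.reverse_eq]), List.prefix_append _ _⟩, ?_⟩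
  rintro v' hv' ⟨t, rfl⟩
  have hrev := hv'.reverse_eq
  have hx : x.length ≤ t.length := by
    by_cases hlt : (x ++ y).length ≤ t.length
    · simp only [List.length_append] at hlt; omega
    -- Stripping `t.reverse` and `t` from the two ends of the palindrome leaves a palindromic suffix
    -- of `x ++ y`, to which minimality of `x` applies.
    · have hpre : t.reverse <+: x ++ y := by
        refine List.prefix_of_prefix_length_le (l₃ := x ++ y ++ t) ?_ (List.prefix_append _ _)
          (by rw [List.length_reverse]; omega)
        rw [← hrev, List.reverse_append]
        exact List.prefix_append _ _
      obtain ⟨y', hy'⟩ := hpre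
      have hpal : y'.Palindrome := by
        apply List.Palindrome.of_reverse_eq
        rw [← hy'] at hrev
        simpa using hrev
      simpa using hmin _ _ hy' hpal
  simp only [List.length_append, List.length_reverse]
  omega

/-- A right palindromic closure is obtained by completing a longest palindromic suffix. -/
theorem IsRightPalClosure.exists_longest {u v : List A} (h : IsRightPalClosure u v) :
    ∃ x y : List A, u = x ++ y ∧ v = x ++ y ++ x.reverse ∧ y.Palindrome ∧
      ∀ x' y' : List A, x' ++ y' = x ++ y → y'.Palindrome → x.length ≤ x'.length := by
  classical
  have hne : ∃ n : ℕ, ∃ x y : List A, x.length = n ∧ x ++ y = u ∧ y.Palindrome :=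
    ⟨_, u, [], rfl, by simp, List.Palindrome.nil⟩
  obtain ⟨x, y, hlen, rfl, hpal⟩ := Nat.find_spec hne
  have hmin : ∀ x' y' : List A, x' ++ y' = x ++ y → y'.Palindrome → x.length ≤ x'.length :=
    fun x' y' h1 h2 => hlen ▸ Nat.find_min' hne ⟨x', y', rfl, h1, h2⟩
  exact ⟨x, y, rfl, (existsUnique_isRightPalClosure _).unique h
    (isRightPalClosure_of_longest hpal hmin), hpal, hmin⟩

end PalindromicClosure

/-! ### Prefixes and factors of sequences -/

section SeqPrefix

variable {A : Type*}

theorem IsSeqPrefix.of_prefix {u v : List A} {s : ℕ → A} (hv : IsSeqPrefix v s) (h : u <+: v) :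
    IsSeqPrefix u s := fun i hi => by
  rw [h.getElem hi]
  exact hv i _

theorem isSeqPrefix_map_range (s : ℕ → A) (n : ℕ) : IsSeqPrefix ((List.range n).map s) s := by
  intro i hi
  simp

theorem IsSeqPrefix.eq_map_range {u : List A} {s : ℕ → A} (h : IsSeqPrefix u s) :
    u = (List.range u.length).map s := by
  refine List.ext_getElem (by simp) fun i h1 h2 => ?_
  simp [h i h1]

theorem IsSeqPrefix.prefix_of_length_le {u v : List A} {s : ℕ → A} (hu : IsSeqPrefix u s)
    (hv : IsSeqPrefix v s) (h : u.length ≤ v.length) : u <+: v := by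
  rw [List.prefix_iff_eq_take]
  refine List.ext_getElem (by simpa using h) fun i h1 h2 => ?_
  simp [hu i h1, hv i (by omega)]

theorem isSeqFactor_iff {u : List A} {s : ℕ → A} :
    IsSeqFactor u s ↔ ∃ p, IsSeqPrefix (p ++ u) s := by
  constructor
  · rintro ⟨k, hk⟩
    refine ⟨(List.range k).map s, fun i hi => ?_⟩
    by_cases h : i < k
    · rw [List.getElem_append_left (by simpa using h)]
      simp
    · rw [List.getElem_append_right (by simpa using h), hk]
      simp only [List.length_map, List.length_range]
      congr 1
      omega
  · rintro ⟨p, hp⟩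
    refine ⟨p.length, fun i hi => ?_⟩
    rw [← hp (p.length + i) (by simpa using hi)]
    simp

theorem IsSeqFactor.of_infix {u v : List A} {s : ℕ → A} (hv : IsSeqFactor v s) (h : u <:+: v) :
    IsSeqFactor u s := by
  obtain ⟨p, hp⟩ := isSeqFactor_iff.1 hv
  obtain ⟨x, y, rfl⟩ := h
  exact isSeqFactor_iff.2 ⟨p ++ x, hp.of_prefix ⟨y, by simp⟩⟩

theorem IsStandardEpisturmian.isEpisturmian {s : ℕ → A} (h : IsStandardEpisturmian s) :
    IsEpisturmian s := ⟨s, h, rfl⟩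

theorem isStandardEpisturmian_const (a : A) : IsStandardEpisturmian fun _ => a := by
  intro u hu
  have huv : u = List.replicate u.length a :=
    List.eq_replicate_iff.2 ⟨rfl, fun b hb => by
      obtain ⟨i, hi, rfl⟩ := List.getElem_of_mem hb
      exact hu i hi⟩
  refine ⟨u, ⟨⟨List.Palindrome.of_reverse_eq ?_, List.prefix_rfl⟩,
    fun v' _ h => h.length_le⟩, hu⟩
  rw [huv, List.reverse_replicate]

theorem IsStandardEpisturmian.map_equiv {s : ℕ → A} (hs : IsStandardEpisturmian s)
    (e : Equiv.Perm A) : IsStandardEpisturmian (e ∘ s) := by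
  intro u hu
  have hu' : IsSeqPrefix (u.map e.symm) s := fun i hi => by
    simp only [List.length_map] at hi
    simp [hu i hi]
  obtain ⟨v, ⟨⟨hv, huv⟩, hmin⟩, hvs⟩ := hs _ hu'
  refine ⟨v.map e, ⟨⟨hv.map _, ?_⟩, fun v' hv' h => ?_⟩, fun i hi => ?_⟩
  · simpa using huv.map e
  · simpa using hmin (v'.map e.symm) (hv'.map _) (h.map _)
  · simp only [List.length_map] at hi
    simp [hvs i hi]

end SeqPrefix

/-! ### The morphism `ψ_a` on words and sequences -/

section PsiWord

variable {A : Type*} [DecidableEq A]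

/-- The action of `ψ_a` on words, as lists of letters. -/
def psiWord (a : A) (u : List A) : List A :=
  u.flatMap fun x => if x = a then [a] else [a, x]

@[simp] theorem psiWord_nil (a : A) : psiWord a [] = [] := rfl

theorem psiWord_cons (a x : A) (u : List A) :
    psiWord a (x :: u) = a :: ((if x = a then [] else [x]) ++ psiWord a u) := by
  by_cases h : x = a <;> simp [psiWord, h]

@[simp] theorem psiWord_append (a : A) (u v : List A) :
    psiWord a (u ++ v) = psiWord a u ++ psiWord a v := by
  simp [psiWord]

/-- Synchronization: the letter `a` occurs exactly at the start of each block, so a cut just before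
an `a` comes from a cut of `p`; the final `[a]` stands for the start of a next block. -/
theorem psiWord_eq_append (a : A) (p x t : List A) (h : psiWord a p ++ [a] = x ++ a :: t) :
    ∃ q r, p = q ++ r ∧ x = psiWord a q ∧ a :: t = psiWord a r ++ [a] := by
  induction p generalizing x with
  | nil =>
    refine ⟨[], [], rfl, ?_⟩
    cases x <;> simp_all
  | cons b p ih =>
    rw [psiWord_cons] at h
    rcases x with _ | ⟨c, x⟩
    · exact ⟨[], b :: p, rfl, rfl, by rw [psiWord_cons]; simpa using h.symm⟩
    · by_cases hb : b = a
      · simp only [hb, if_true, List.nil_append, List.cons_append, List.cons.injEq] at h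
        obtain ⟨q, r, rfl, rfl, h3⟩ := ih x h.2
        exact ⟨b :: q, r, rfl, by simp [psiWord_cons, hb, h.1], h3⟩
      · simp only [hb, if_false, List.cons_append, List.nil_append, List.cons.injEq] at h
        rcases x with _ | ⟨d, x⟩
        · simp only [List.nil_append, List.cons.injEq] at h
          exact absurd h.2.1 hb
        · simp only [List.cons_append, List.cons.injEq] at h
          obtain ⟨q, r, rfl, rfl, h3⟩ := ih x h.2.2
          exact ⟨b :: q, r, rfl, by simp [psiWord_cons, ← h.1, ← h.2.1, hb], h3⟩

theorem psiWord_eq_append_of_ne (a : A) (p x t : List A) (c : A) (hc : c ≠ a)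
    (h : psiWord a p = x ++ c :: t) : ∃ x', x = x' ++ [a] := by
  induction p generalizing x with
  | nil => simp at h
  | cons b p ih =>
    rw [psiWord_cons] at h
    rcases x with _ | ⟨d, x⟩
    · simp only [List.nil_append, List.cons.injEq] at h
      exact absurd h.1.symm hc
    · simp only [List.cons_append, List.cons.injEq] at h
      obtain ⟨rfl, h⟩ := h
      rcases x with _ | ⟨e, x⟩
      · exact ⟨[], rfl⟩
      · have : ∃ x1, psiWord a p = x1 ++ c :: t ∧ x1 <:+ e :: x := by
          by_cases hb : b = a
          · exact ⟨e :: x, by simpa [hb] using h, List.suffix_rfl⟩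
          · simp only [hb, if_false, List.cons_append, List.nil_append, List.cons.injEq] at h
            exact ⟨x, h.2, List.suffix_cons _ _⟩
        obtain ⟨x1, h1, y, h2⟩ := this
        obtain ⟨x', rfl⟩ := ih x1 h1
        exact ⟨a :: (y ++ x'), by simp [← h2]⟩

theorem prefix_psiWord (a : A) (p u : List A) (h : u <+: psiWord a p) :
    ∃ q, q <+: p ∧ (u = psiWord a q ∨ u = psiWord a q ++ [a]) := by
  induction p generalizing u with
  | nil => exact ⟨[], List.prefix_rfl, Or.inl (by simpa using h)⟩
  | cons b p ih =>
    rw [psiWord_cons] at h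
    rcases u with _ | ⟨c, u⟩
    · exact ⟨[], List.nil_prefix, by simp⟩
    · rw [List.cons_prefix_cons] at h
      obtain ⟨rfl, h⟩ := h
      by_cases hb : b = c
      · simp only [hb, if_true, List.nil_append] at h
        obtain ⟨q, hq, hu⟩ := ih u h
        exact ⟨b :: q, by simpa using hq, by simpa [psiWord_cons, hb] using hu⟩
      · simp only [hb, if_false, List.cons_append, List.nil_append] at h
        rcases u with _ | ⟨d, u⟩
        · exact ⟨[], List.nil_prefix, by simp⟩
        · rw [List.cons_prefix_cons] at h
          obtain ⟨rfl, h⟩ := h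
          obtain ⟨q, hq, hu⟩ := ih u h
          exact ⟨d :: q, by simpa using hq, by simpa [psiWord_cons, hb] using hu⟩

theorem psiWord_injective (a : A) : Function.Injective (psiWord a) := by
  intro u v h
  induction u generalizing v with
  | nil => cases v <;> simp_all [psiWord_cons]
  | cons b u ih =>
    cases v with
    | nil => simp [psiWord_cons] at h
    | cons c v =>
      have key : ∀ (d : A) (u v : List A), d ≠ a → psiWord a u ≠ d :: v := by
        intro d u v hd hu
        cases u with
        | nil => simp at hu
        | cons e u => exact hd (List.cons.inj (psiWord_cons a e u ▸ hu)).1.symm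
      simp only [psiWord_cons, List.cons.injEq, true_and] at h
      by_cases hb : b = a <;> by_cases hc : c = a
      · simp [hb, hc] at h ⊢; exact ih h
      · simp [hb, hc] at h; exact absurd h (key _ _ _ hc)
      · simp [hb, hc] at h; exact absurd h.symm (key _ _ _ hb)
      · simp [hb, hc] at h ⊢; exact ⟨h.1, ih h.2⟩

/-- The extra `a` closes the last block on the right, which makes the coding symmetric under
reversal. -/
theorem reverse_psiWord_append (a : A) (u : List A) :
    (psiWord a u ++ [a]).reverse = psiWord a u.reverse ++ [a] := by
  induction u with
  | nil => simp
  | cons b u ih =>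
    rw [psiWord_cons, List.reverse_cons (as := u), psiWord_append, List.cons_append, List.append_assoc,
      List.reverse_cons, List.reverse_append, ih]
    by_cases hb : b = a <;> simp [hb, psiWord_cons]

theorem palindrome_psiWord_append_iff (a : A) (u : List A) :
    (psiWord a u ++ [a]).Palindrome ↔ u.Palindrome := by
  rw [List.Palindrome.iff_reverse_eq, List.Palindrome.iff_reverse_eq, reverse_psiWord_append,
    List.append_left_inj, (psiWord_injective a).eq_iff]

theorem length_le_length_psiWord (a : A) (u : List A) : u.length ≤ (psiWord a u).length := by
  induction u with
  | nil => simp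
  | cons b u ih =>
    simp only [psiWord_cons, List.length_cons, List.length_append]
    omega

/-- Each block has one `a` and at most one other letter. This drives the counterexample. -/
theorem length_psiWord_le_two_mul_count (a : A) (u : List A) :
    (psiWord a u).length ≤ 2 * (psiWord a u).count a := by
  induction u with
  | nil => simp
  | cons b u ih =>
    by_cases hb : b = a <;> simp [psiWord_cons, hb] <;> omega

theorem psiWord_prefix_psiWord (a : A) {u v : List A} (h : u <+: v) :
    psiWord a u <+: psiWord a v := by
  obtain ⟨t, rfl⟩ := h
  exact ⟨psiWord a t, by simp⟩

/-- The image of a sequence under `ψ_a`. -/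
def psiSeq (a : A) (s : ℕ → A) (n : ℕ) : A :=
  -- Letters have nonempty images, so the image of the first `n + 1` letters reaches position `n`.
  (psiWord a ((List.range (n + 1)).map s))[n]'(by
    have := length_le_length_psiWord a ((List.range (n + 1)).map s)
    simp only [List.length_map, List.length_range] at this
    omega)

theorem isSeqPrefix_psiWord (a : A) {s : ℕ → A} {u : List A} (hu : IsSeqPrefix u s) :
    IsSeqPrefix (psiWord a u) (psiSeq a s) := by
  intro i hi
  have hv := isSeqPrefix_map_range s (i + 1)
  rcases le_total u.length ((List.range (i + 1)).map s).length with h | h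
  · exact (psiWord_prefix_psiWord a (hu.prefix_of_length_le hv h)).getElem hi
  · exact ((psiWord_prefix_psiWord a (hv.prefix_of_length_le hu h)).getElem _).symm

theorem isSeqPrefix_psiWord_append (a : A) {s : ℕ → A} {u : List A} (hu : IsSeqPrefix u s) :
    IsSeqPrefix (psiWord a u ++ [a]) (psiSeq a s) := by
  have h := isSeqPrefix_psiWord a (isSeqPrefix_map_range s (u.length + 1))
  rw [List.range_succ, List.map_append, ← hu.eq_map_range, psiWord_append] at h
  refine h.of_prefix ?_
  rw [List.map_singleton, psiWord_cons]
  simp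

theorem exists_of_isSeqPrefix_psiSeq (a : A) {s : ℕ → A} {u : List A}
    (hu : IsSeqPrefix u (psiSeq a s)) :
    ∃ q, IsSeqPrefix q s ∧ (u = psiWord a q ∨ u = psiWord a q ++ [a]) := by
  have hv := isSeqPrefix_map_range s u.length
  have hlen := length_le_length_psiWord a ((List.range u.length).map s)
  obtain ⟨q, hq, h⟩ := prefix_psiWord a _ _
    (hu.prefix_of_length_le (isSeqPrefix_psiWord a hv) (by simpa using hlen))
  exact ⟨q, hv.of_prefix hq, h⟩

/-- A nonempty palindromic suffix of `ψ_a(u)a` ends, hence begins, with `a`; by synchronization it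
is `ψ_a(r)a` for a palindromic suffix `r` of `u`. -/
theorem longest_palindrome_suffix_psiWord_append (a : A) {x y : List A}
    (hmin : ∀ x' y' : List A, x' ++ y' = x ++ y → y'.Palindrome → x.length ≤ x'.length)
    (x' y' : List A) (h : x' ++ y' = psiWord a (x ++ y) ++ [a]) (hy' : y'.Palindrome) :
    (psiWord a x).length ≤ x'.length := by
  rcases y' with _ | ⟨c, t⟩
  · rw [List.append_nil] at h
    simp [h]
  · have hc : c = a := by
      have h1 : (c :: t).getLast? = some a := by
        have := congrArg List.getLast? h
        simpa [List.getLast?_append] using this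
      rw [← hy'.reverse_eq] at h1
      simpa using h1
    subst hc
    obtain ⟨q, r, hqr, rfl, hr⟩ := psiWord_eq_append _ _ _ _ h.symm
    rw [hr, palindrome_psiWord_append_iff] at hy'
    have hle := hmin q r hqr.symm hy'
    exact (psiWord_prefix_psiWord c (List.prefix_of_prefix_length_le
      (List.prefix_append x y) (hqr ▸ List.prefix_append q r) hle)).length_le

theorem psiWord_append_reverse (a : A) (x y : List A) :
    psiWord a x ++ (psiWord a y ++ [a]) ++ (psiWord a x).reverse =
      psiWord a (x ++ y ++ x.reverse) ++ [a] := by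
  have h := reverse_psiWord_append a x
  rw [List.reverse_append, List.reverse_singleton] at h
  simp only [psiWord_append, List.append_assoc, ← h]

theorem IsStandardEpisturmian.psiSeq {s : ℕ → A} (hs : IsStandardEpisturmian s) (a : A) :
    IsStandardEpisturmian (psiSeq a s) := by
  have endsWith : ∀ q, IsSeqPrefix q s → ∃ v,
      IsRightPalClosure (psiWord a q ++ [a]) v ∧ IsSeqPrefix v (_root_.psiSeq a s) := by
    intro q hq
    obtain ⟨v, hv, hvs⟩ := hs q hq
    obtain ⟨x, y, rfl, rfl, hy, hmin⟩ := hv.exists_longest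
    refine ⟨psiWord a (x ++ y ++ x.reverse) ++ [a], ?_, isSeqPrefix_psiWord_append a hvs⟩
    rw [← psiWord_append_reverse, psiWord_append, List.append_assoc]
    refine isRightPalClosure_of_longest ((palindrome_psiWord_append_iff a y).2 hy)
      fun x' y' h hy' => longest_palindrome_suffix_psiWord_append a hmin x' y' ?_ hy'
    rw [h, psiWord_append, List.append_assoc]
  intro u hu
  obtain ⟨q, hq, rfl | rfl⟩ := exists_of_isSeqPrefix_psiSeq a hu
  swap
  · exact endsWith q hq
  rcases q.eq_nil_or_concat with rfl | ⟨p, b, rfl⟩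
  · exact ⟨[], ⟨⟨List.Palindrome.nil, List.prefix_rfl⟩, fun _ _ _ => Nat.zero_le _⟩, hu⟩
  rw [List.concat_eq_append] at *
  -- If the last letter is `a`, then `ψ_a(pa) = ψ_a(p)a` falls under `endsWith`. Otherwise the
  -- closure of `ψ_a(q)` coincides with that of `ψ_a(q)a`.
  by_cases hb : b = a
  · have h := endsWith p (hq.of_prefix (List.prefix_append _ _))
    simpa [hb, psiWord_cons] using h
  · obtain ⟨v, hv, hvs⟩ := hs _ hq
    obtain ⟨x, y, hxy, rfl, hy, hmin⟩ := hv.exists_longest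
    have hyne : y ≠ [] := by
      rintro rfl
      have := hmin p [b] (by rw [hxy]) (List.Palindrome.singleton b)
      have h2 := congrArg List.length hxy
      simp at h2
      omega
    obtain ⟨c, y1, rfl⟩ := List.exists_cons_of_ne_nil hyne
    -- Removing the outer letters `a` of the palindrome `ψ_a(y)a` leaves `m`, the longest
    -- palindromic suffix of `ψ_a(q)`.
    obtain ⟨m, hm⟩ : ∃ m, psiWord a (c :: y1) = a :: m := ⟨_, psiWord_cons a c y1⟩
    have hpal := (palindrome_psiWord_append_iff a _).2 hy
    rw [hm] at hpal
    have hmpal : m.Palindrome := List.Palindrome.of_reverse_eq (by simpa using hpal.reverse_eq)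
    have hu' : psiWord a (p ++ [b]) = (psiWord a x ++ [a]) ++ m := by
      rw [hxy, psiWord_append, hm]; simp
    refine ⟨psiWord a (x ++ (c :: y1) ++ x.reverse) ++ [a], ?_, isSeqPrefix_psiWord_append a hvs⟩
    rw [← psiWord_append_reverse, hm, hu']
    have hcl : IsRightPalClosure (psiWord a x ++ [a] ++ m)
        (psiWord a x ++ [a] ++ m ++ (psiWord a x ++ [a]).reverse) := by
      refine isRightPalClosure_of_longest hmpal fun x' y' h hy' => ?_
      rw [← hu'] at h
      rcases y' with _ | ⟨d, t⟩
      · rw [List.append_nil] at h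
        rw [h, hu']
        simp
      · have hd : d = b := by
          have h1 : (d :: t).getLast? = some b := by
            have := congrArg List.getLast? h
            simpa [List.getLast?_append, psiWord_cons, hb] using this
          rw [← hy'.reverse_eq] at h1
          simpa using h1
        subst hd
        -- The suffix starts with a letter other than `a`, so an `a` precedes it; adding `a` on both
        -- sides gives a palindromic suffix of `ψ_a(q)a`.
        obtain ⟨x1, rfl⟩ := psiWord_eq_append_of_ne a _ _ _ _ hb h.symm
        have := longest_palindrome_suffix_psiWord_append a hmin x1 (a :: (d :: t) ++ [a])
          (by rw [← hxy, ← h]; simp)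
          (List.Palindrome.of_reverse_eq (by
            have := hy'.reverse_eq
            rw [List.reverse_append, List.reverse_cons (as := d :: t), this]; simp))
        simpa using this
    simpa using hcl

theorem psi_of (a b : A) : psi a (FreeMonoid.of b) =
    if b = a then FreeMonoid.of a else FreeMonoid.of a * FreeMonoid.of b :=
  FreeMonoid.lift_eval_of _ _

theorem psiBar_of (a b : A) : psiBar a (FreeMonoid.of b) =
    if b = a then FreeMonoid.of a else FreeMonoid.of b * FreeMonoid.of a :=
  FreeMonoid.lift_eval_of _ _

theorem psi_ofList (a : A) (u : List A) :
    psi a (FreeMonoid.ofList u) = FreeMonoid.ofList (psiWord a u) := by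
  induction u with
  | nil => simp
  | cons b u ih =>
    rw [FreeMonoid.ofList_cons, map_mul, ih, psiWord_cons]
    by_cases hb : b = a <;> simp [psi_of, hb, FreeMonoid.ofList_cons, mul_assoc]

theorem of_mul_psiBar (a : A) (u : FreeMonoid A) :
    FreeMonoid.of a * psiBar a u = psi a u * FreeMonoid.of a := by
  induction u using FreeMonoid.inductionOn' with
  | one => simp
  | of_mul b u ih =>
    rw [map_mul, map_mul, mul_assoc, ← ih]
    by_cases hb : b = a <;> simp [psi_of, psiBar_of, hb, mul_assoc]

end PsiWord

/-! ### Periods, fractional roots and powers -/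

section WordPowers

variable {A : Type*}

theorem isSeqFactor_replicate (n : ℕ) (a : A) : IsSeqFactor (List.replicate n a) fun _ => a :=
  ⟨0, fun i hi => by simp⟩

theorem smallestPeriod_spec {w : List A} (hw : w ≠ []) :
    smallestPeriod w ≠ 0 ∧ w.HasPeriod (smallestPeriod w) :=
  Nat.sInf_mem (s := {p : ℕ | p ≠ 0 ∧ w.HasPeriod p})
    ⟨w.length, by simpa using hw, by simp [List.HasPeriod]⟩

/-- A word with period `p` is a prefix of a power of its prefix of length `p`. -/
theorem prefix_pow_of_hasPeriod {w : List A} {p : ℕ} (hp : w.HasPeriod p) (n : ℕ) :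
    w <+: (List.replicate n (w.take p)).flatten ++ w := by
  induction n with
  | zero => simp
  | succ n ih =>
    rw [List.replicate_succ, List.flatten_cons, List.append_assoc]
    exact hp.trans ((List.prefix_append_right_inj _).2 ih)

theorem prefix_pow_fractionalRoot {w : List A} (hw : w ≠ []) :
    w <+: (List.replicate w.length (fractionalRoot w)).flatten := by
  obtain ⟨h0, hp⟩ := smallestPeriod_spec hw
  refine List.prefix_of_prefix_length_le (prefix_pow_of_hasPeriod hp w.length)
    (List.prefix_append _ _) ?_
  have hpos : 0 < w.length := List.length_pos_iff.2 hw
  simp only [List.length_flatten, List.map_replicate, List.sum_replicate, smul_eq_mul]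
  refine Nat.le_mul_of_pos_right _ ?_
  rw [fractionalRoot, List.length_take]
  omega

theorem toList_map_replicate (f : Monoid.End (FreeMonoid A)) (n : ℕ) (a : A) :
    (f (FreeMonoid.ofList (List.replicate n a))).toList =
      (List.replicate n (f (FreeMonoid.of a)).toList).flatten := by
  induction n with
  | zero => simp
  | succ n ih =>
    rw [List.replicate_succ, FreeMonoid.ofList_cons, map_mul, FreeMonoid.toList_mul, ih,
      List.replicate_succ, List.flatten_cons]

theorem fractionalRoot_of_distinct {a b c : A} (hbc : b ≠ c) (hac : a ≠ c) :
    fractionalRoot [b, a, c] = [b, a, c] := by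
  obtain ⟨h0, hp⟩ := smallestPeriod_spec (w := [b, a, c]) (by simp)
  unfold fractionalRoot
  generalize smallestPeriod [b, a, c] = p at *
  rcases p with _ | _ | _ | p
  · exact absurd rfl h0
  -- Period 1 would force `a = c`, and period 2 would force `b = c`.
  · simp [List.HasPeriod] at hp
    grind
  · simp [List.HasPeriod] at hp
    grind
  · simp

end WordPowers

/-! ### Episturmian morphisms: factors and distinct letters -/

section Morphisms

variable {A : Type*} [DecidableEq A]

/-- The images under an episturmian morphism of the factors of a standard episturmian sequence are
factors of a single standard episturmian sequence. -/
theorem exists_isStandardEpisturmian_of_mem {f : Monoid.End (FreeMonoid A)}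
    (hf : f ∈ episturmianMorphisms A) {s : ℕ → A} (hs : IsStandardEpisturmian s) :
    ∃ s' : ℕ → A, IsStandardEpisturmian s' ∧
      ∀ u : List A, IsSeqFactor u s → IsSeqFactor (f (FreeMonoid.ofList u)).toList s' := by
  induction hf using Submonoid.closure_induction generalizing s with
  | one => exact ⟨s, hs, fun u hu => hu⟩
  | mul f g _ _ ihf ihg =>
    obtain ⟨s1, h1, h1'⟩ := ihg hs
    obtain ⟨s2, h2, h2'⟩ := ihf h1
    exact ⟨s2, h2, fun u hu => h2' _ (h1' u hu)⟩
  | mem f hf =>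
    rcases hf with (⟨a, rfl⟩ | ⟨a, rfl⟩) | ⟨⟨a, b⟩, rfl⟩
    · refine ⟨psiSeq a s, hs.psiSeq a, fun u hu => ?_⟩
      obtain ⟨p, hp⟩ := isSeqFactor_iff.1 hu
      rw [psi_ofList, FreeMonoid.toList_ofList, isSeqFactor_iff]
      exact ⟨psiWord a p, by simpa using isSeqPrefix_psiWord a hp⟩
    · refine ⟨psiSeq a s, hs.psiSeq a, fun u hu => ?_⟩
      obtain ⟨p, hp⟩ := isSeqFactor_iff.1 hu
      have h := congrArg FreeMonoid.toList (of_mul_psiBar a (FreeMonoid.ofList u))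
      rw [psi_ofList, FreeMonoid.toList_mul, FreeMonoid.toList_mul, FreeMonoid.toList_of,
        FreeMonoid.toList_ofList] at h
      rw [isSeqFactor_iff]
      -- Since `a ψ̄_a(u) = ψ_a(u) a`, the word `ψ_a(p) a ψ̄_a(u)` equals `ψ_a(pu) a`.
      refine ⟨psiWord a p ++ [a], ?_⟩
      rw [List.append_assoc, h, ← List.append_assoc, ← psiWord_append]
      exact isSeqPrefix_psiWord_append a hp
    · refine ⟨Equiv.swap a b ∘ s, hs.map_equiv _, ?_⟩
      rintro u ⟨k, hk⟩
      refine ⟨k, fun i hi => ?_⟩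
      have h : (theta a b (FreeMonoid.ofList u)).toList = u.map (Equiv.swap a b) := rfl
      simp only [h, List.length_map] at hi
      simp [h, hk i hi]

/-- A c-epichristoffel word with pairwise distinct letters has length at most two. -/
theorem length_le_two_of_nodup {f : Monoid.End (FreeMonoid A)}
    (hf : f ∈ episturmianMorphisms A) (a : A) (h : (f (FreeMonoid.of a)).toList.Nodup) :
    (f (FreeMonoid.of a)).toList.length ≤ 2 := by
  -- Only the outermost generator matters: for `ψ` or `ψ̄` counting one letter suffices, and the
  -- induction hypothesis is needed only for `θ`.
  induction hf using Submonoid.closure_induction_left with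
  | one => simp
  | mul_left g hg f _ ih =>
    have hmul : (g * f) (FreeMonoid.of a) = g (f (FreeMonoid.of a)) := rfl
    rw [hmul] at h ⊢
    generalize f (FreeMonoid.of a) = z at *
    have key : ∀ b, (psi b z).toList.Nodup → (psi b z).toList.length ≤ 2 := by
      intro b hb
      have h1 : (psi b z).toList = psiWord b z.toList := by
        rw [← FreeMonoid.ofList_toList z, psi_ofList]; rfl
      have h2 := length_psiWord_le_two_mul_count b z.toList
      have h3 := List.nodup_iff_count_le_one.1 hb b
      rw [h1] at h3 ⊢
      omega
    rcases hg with (⟨b, rfl⟩ | ⟨b, rfl⟩) | ⟨⟨b, c⟩, rfl⟩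
    · exact key b h
    · have hp : (psiBar b z).toList.Perm (psi b z).toList := by
        have h1 := congrArg FreeMonoid.toList (of_mul_psiBar b z)
        rw [FreeMonoid.toList_mul, FreeMonoid.toList_mul, FreeMonoid.toList_of] at h1
        rw [← List.perm_cons b]
        have h2 := h1 ▸ List.perm_append_singleton b (psi b z).toList
        simpa using h2
      rw [hp.length_eq]
      exact key b (hp.nodup_iff.1 h)
    · have h1 : (theta b c z).toList = z.toList.map (Equiv.swap b c) := rfl
      rw [h1] at h ⊢
      rw [List.length_map]
      exact ih h.of_map

end Morphisms

/-! ### The implication and its failing converse -/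

theorem mainTheorem5 {A : Type*} [Finite A] [DecidableEq A] :
    (∀ w : List A, w ≠ [] → IsCEpichristoffel (fractionalRoot w) →
      ∃ s : ℕ → A, IsEpisturmian s ∧ IsSeqFactor w s) ∧
    (3 ≤ Nat.card A →
      ∃ w : List A, w ≠ [] ∧ (∃ s : ℕ → A, IsEpisturmian s ∧ IsSeqFactor w s) ∧
        ¬ IsCEpichristoffel (fractionalRoot w)) := by
  constructor
  · rintro w hw ⟨f, hf, a, hfa⟩
    obtain ⟨s, hs, h⟩ := exists_isStandardEpisturmian_of_mem hf (isStandardEpisturmian_const a)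
    refine ⟨s, hs.isEpisturmian, ?_⟩
    have h1 := h _ (isSeqFactor_replicate w.length a)
    rw [toList_map_replicate, hfa, FreeMonoid.toList_ofList] at h1
    exact h1.of_infix (prefix_pow_fractionalRoot hw).isInfix
  · intro hcard
    have := Fintype.ofFinite A
    rw [Nat.card_eq_fintype_card] at hcard
    obtain ⟨a, b, c, hab, hac, hbc⟩ := Fintype.two_lt_card_iff.1 hcard
    refine ⟨[b, a, c], by simp, ?_, ?_⟩
    · refine ⟨psiSeq a (psiSeq b fun _ => c),
        (((isStandardEpisturmian_const c).psiSeq b).psiSeq a).isEpisturmian, ?_⟩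
      have h : IsSeqPrefix [c] fun _ => c := fun i hi => by simp
      -- `ψ_a(ψ_b(c)) = abac`, so `bac` occurs after the prefix `a`.
      refine isSeqFactor_iff.2 ⟨[a], ?_⟩
      simpa [psiWord_cons, hab.symm, hac.symm, hbc.symm] using
        isSeqPrefix_psiWord a (isSeqPrefix_psiWord b h)
    · rw [fractionalRoot_of_distinct hbc hac]
      rintro ⟨f, hf, x, hx⟩
      have h := length_le_two_of_nodup hf x
      rw [hx] at h
      simp [hab.symm, hac, hbc] at h
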